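/- **Setting.** Fix a function-free first-order signature (without equality) with a set $\mathbf P$ of predicate symbols and an infinite set $\Delta$ of constants. A (Herbrand) interpretation is a set of ground atoms; $\mathcal I$ is the set of all interpretations. MKNF formulae are built from atoms by $\lnot,\land,\exists$ and the modal operators $\mathbf K$, $\mathbf{not}$; for an interpretation $I$ and $M,N\subseteq\mathcal I$, satisfaction in $(I,M,N)$ is as usual for ground atoms (truth in $I$), $\lnot$, $\land$, $\exists$ (over $c\in\Delta$), while $(I,M,N)\models\mathbf K\phi$ iff $(J,M,N)\models\phi$ for all $J\in M$, and $(I,M,N)\models\mathbf{not}\,\phi$ iff $(J,M,N)\not\models\phi$ for some $J\in N$. For a set $T$ of sentences, $M\models T$ means $(I,M,M)\models\phi$ for all $\phi\in T$, $I\in M$. An MKNF interpretation is a nonempty $M\subseteq\mathcal I$. For a first-order theory $T$ (a set of sentences without modal operators), $\mathsf{mod}(T)$ is the greatest $M\subseteq\mathcal I$ with $M\models T$. For any expression, $\mathsf{pr}(\cdot)$ is the set of predicate symbols occurring in it. **Minimal change update.** Put $J\le_I J'$ if for every $P\in\mathbf P$ the set of $P$-atoms on which $I$ and $J$ differ is contained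 in the set of $P$-atoms on which $I$ and $J'$ differ, and $J<_I J'$ if $J\le_I J'$ and not $J'\le_I J$. Let $I\oplus N=\{J\in N: \text{there is no } J'\in N \text{ with } J'<_I J\}$ and $M\oplus N=\bigcup_{I\in M}(I\oplus N)$. For theories $T_0,\dots,T_{n-1}$ let $\mathsf{mod}(\langle T_i\rangle_{i<n})=(\cdots((\mathcal I\oplus\mathsf{mod}(T_0))\oplus\mathsf{mod}(T_1))\cdots)\oplus\mathsf{mod}(T_{n-1})$ (so it is $\mathcal I$ for $n=0$, and $\mathcal I\oplus\mathsf{mod}(T_0)=\mathsf{mod}(T_0)$). If it is nonempty, it is called the *minimal change update model* of $\langle T_i\rangle_{i<n}$. **Programs.** A literal is a ground atom $p$ or a default literal $\mathit{not}\,p$, with $\mathit{not}\,\mathit{not}\,p=p$; a rule $r$ has a head literal $H(r)$ and a finite set $B(r)$ of body literals; a program is a set of rules. A rule is positive if its head is an atom, and a fact if its body is empty. An interpretation $I$ is a *dynamic stable model* of a finite sequence of programs $\langle P_i\rangle_{i<n}$ if $I\cup\{\mathit{not}\,p: p\notin I\}$ is the least model (default literals being read as new atoms) of the program consisting of (i)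 every occurrence of a rule $r\in P_i$ for which there are no $j\ge i$ and $r'\in P_j$ with $H(r)=\mathit{not}\,H(r')$ and $I\models B(r')$, and (ii) the facts $\mathit{not}\,p$ for all atoms $p$ such that no rule $r\in\bigcup_i P_i$ has $H(r)=p$ and $I\models B(r)$. **Hybrid knowledge bases.** Fix a description logic, i.e. a set of axioms together with a translation $\kappa$ of each axiom $\phi$ to a first-order sentence $\kappa(\phi)$; $\mathsf{pr}(\phi)=\mathsf{pr}(\kappa(\phi))$ and $\kappa(O)=\{\kappa(\phi):\phi\in O\}$. A hybrid knowledge base is a pair $\langle O,P\rangle$ of a set of axioms and a program; a dynamic hybrid knowledge base is a finite sequence $\mathcal K=\langle\langle O_i,P_i\rangle\rangle_{i<n}$ of such pairs. $\mathcal K$ is *$O$-based* if all rules of all $P_i$ are positive facts, and *$P$-based* if all $O_i$ are empty. If $\mathcal K$ is $O$-based or $P$-based, an MKNF interpretation $M$ is a *basic dynamic MKNF model* of $\mathcal K$ if either $\mathcal K$ is $O$-based and $M$ is the minimal change update model of $\langle\kappa(O_i)\cup P_i\rangle_{i<n}$ (facts being read as ground atoms), or $\mathcal K$ is $P$-based and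 $M=\{J\in\mathcal I: I\subseteq J\}$ for some dynamic stable model $I$ of $\langle P_i\rangle_{i<n}$. A set $U\subseteq\mathbf P$ is a *splitting set* for $\mathcal K$ if for all $i$: every $\phi\in O_i$ with $\mathsf{pr}(\phi)\cap U\neq\emptyset$ has $\mathsf{pr}(\phi)\subseteq U$, and every $r\in P_i$ with $\mathsf{pr}(H(r))\cap U\ne\emptyset$ has $\mathsf{pr}(r)\subseteq U$. The bottom $b_U(\mathcal K)$ keeps in each component exactly the axioms and rules with all predicate symbols in $U$; the top $t_U(\mathcal K)$ keeps the remaining ones. For $X\subseteq\mathcal I$, the reduct $e_U(\mathcal K,X)$ has the ontologies of $t_U(\mathcal K)$ and, in each component, the rules obtained from those rules $r$ of $t_U(\mathcal K)$ such that, for the literals of $B(r)$ with predicate symbol in $U$, $X\models\mathbf K p$ for every such atom $p$ and $X\models\mathbf{not}\,p$ for every such default literal $\mathit{not}\,p$, by deleting from $B(r)$ all literals with predicate symbol in $U$. A *splitting sequence* for $\mathcal K$ is a nonempty sequence $\langle U_\alpha\rangle_{\alpha<\mu}$ of splitting sets, indexed by ordinals, that is monotone, continuous ($U_\alpha=\bigcup_{\eta<\alpha}U_\eta$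 for limit $\alpha$), and has union $\mathbf P$. $\mathcal K$ is *reducible relative to $U$* if either all its rules are positive with $\mathsf{pr}(B(r))\subseteq U$, or all its ontologies are empty. The splitting sequence is *update-enabling* if $b_{U_0}(\mathcal K)$ is reducible relative to $\emptyset$ and $t_{U_\alpha}(b_{U_{\alpha+1}}(\mathcal K))$ is reducible relative to $U_\alpha$ whenever $\alpha+1<\mu$. A *solution* to $\mathcal K$ with respect to it is a sequence $\langle X_\alpha\rangle_{\alpha<\mu}$ of MKNF interpretations such that $X_0$ is a basic dynamic MKNF model of $b_{U_0}(\mathcal K)$; $X_{\alpha+1}$ is a basic dynamic MKNF model of $e_{U_\alpha}(b_{U_{\alpha+1}}(\mathcal K),\bigcap_{\eta\le\alpha}X_\eta)$ whenever $\alpha+1<\mu$; and $X_\alpha=\mathcal I$ for limit $\alpha<\mu$. An MKNF interpretation $M$ is a *dynamic MKNF model* of $\mathcal K$ if $M=\bigcap_{\alpha<\mu}X_\alpha$ for some solution with respect to some update-enabling splitting sequence for $\mathcal K$. **Theorem.** Let $\mathcal K=\langle\langle O_i,P_i\rangle\rangle_{i<n}$ be a dynamic hybrid knowledge base such that $P_i$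 is empty for all $i<n$. Then $M$ is a dynamic MKNF model of $\mathcal K$ if and only if $M$ is the minimal change update model of $\langle\kappa(O_i)\rangle_{i<n}$. -/

import Mathlib

universe u v a w

namespace MKNF

/-! ### Signatures, MKNF formulae and Herbrand interpretations -/

/-- A function-free first-order signature: predicate symbols with arities, and infinitely many
constants. Under the standard names assumption the Herbrand universe is the set of constants. -/
structure Signature where
  Pred : Type u
  arity : Pred → ℕ
  Const : Type v
  infinite_const : Infinite Const

/-- Terms with free variables among `Fin n`. -/
inductive Term (σ : Signature.{u, v}) (n : ℕ) : Type v
  | var (x : Fin n)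
  | const (c : σ.Const)

/-- MKNF formulae with free variables among `Fin n`; in `ex φ` the quantified variable of `φ` is
the last one. -/
inductive Formula (σ : Signature.{u, v}) : ℕ → Type (max u v)
  | atom {n : ℕ} (P : σ.Pred) (t : Fin (σ.arity P) → Term σ n) : Formula σ n
  | neg {n : ℕ} (φ : Formula σ n) : Formula σ n
  | conj {n : ℕ} (φ ψ : Formula σ n) : Formula σ n
  | ex {n : ℕ} (φ : Formula σ (n + 1)) : Formula σ n
  | know {n : ℕ} (φ : Formula σ n) : Formula σ n
  | naf {n : ℕ} (φ : Formula σ n) : Formula σ n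

/-- MKNF sentences: formulae without free variables. -/
abbrev Sentence (σ : Signature.{u, v}) := Formula σ 0

/-- The set of predicate symbols occurring in a formula. -/
def Formula.preds {σ : Signature.{u, v}} : {n : ℕ} → Formula σ n → Set σ.Pred
  | _, .atom P _ => {P}
  | _, .neg φ => φ.preds
  | _, .conj φ ψ => φ.preds ∪ ψ.preds
  | _, .ex φ => φ.preds
  | _, .know φ => φ.preds
  | _, .naf φ => φ.preds

/-- A formula is first-order if no modal operator occurs in it. -/
def Formula.IsFirstOrder {σ : Signature.{u, v}} : {n : ℕ} → Formula σ n → Prop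
  | _, .atom _ _ => True
  | _, .neg φ => φ.IsFirstOrder
  | _, .conj φ ψ => φ.IsFirstOrder ∧ ψ.IsFirstOrder
  | _, .ex φ => φ.IsFirstOrder
  | _, .know _ => False
  | _, .naf _ => False

/-- First-order sentences. -/
abbrev FOSentence (σ : Signature.{u, v}) := {φ : Sentence σ // φ.IsFirstOrder}

/-- Ground atoms `P(c₁, …, cₖ)`. -/
@[ext]
structure GroundAtom (σ : Signature.{u, v}) where
  pred : σ.Pred
  args : Fin (σ.arity pred) → σ.Const

/-- A ground atom regarded as a sentence. -/
def GroundAtom.toSentence {σ : Signature.{u, v}} (p : GroundAtom σ) : Sentence σ :=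
  .atom p.pred fun i => .const (p.args i)

/-- A ground atom regarded as a first-order sentence. -/
def GroundAtom.toFO {σ : Signature.{u, v}} (p : GroundAtom σ) : FOSentence σ :=
  ⟨p.toSentence, trivial⟩

/-- A Herbrand interpretation: the set of ground atoms that are true. -/
abbrev Interp (σ : Signature.{u, v}) := Set (GroundAtom σ)

/-- The value of a term when the variables are replaced by the constants `e`. -/
def Term.eval {σ : Signature.{u, v}} {n : ℕ} (e : Fin n → σ.Const) : Term σ n → σ.Const
  | .var x => e x
  | .const c => c

/-- Satisfaction in the MKNF structure `⟨I, M, N⟩` of the sentence obtained from a formula by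
replacing its free variables by the constants `e`. -/
def Formula.Sat {σ : Signature.{u, v}} (M N : Set (Interp σ)) :
    {n : ℕ} → Formula σ n → Interp σ → (Fin n → σ.Const) → Prop
  | _, .atom P t, I, e => (⟨P, fun i => (t i).eval e⟩ : GroundAtom σ) ∈ I
  | _, .neg φ, I, e => ¬ φ.Sat M N I e
  | _, .conj φ ψ, I, e => φ.Sat M N I e ∧ ψ.Sat M N I e
  | _, .ex φ, I, e => ∃ c : σ.Const, φ.Sat M N I (Fin.snoc (α := fun _ => σ.Const) e c)
  | _, .know φ, _, e => ∀ J ∈ M, φ.Sat M N J e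
  | _, .naf φ, _, e => ∃ J ∈ N, ¬ φ.Sat M N J e

/-- `M ⊨ T`: every sentence of `T` holds in `⟨I, M, M⟩` for every `I ∈ M`. -/
def Models {σ : Signature.{u, v}} (M : Set (Interp σ)) (T : Set (Sentence σ)) : Prop :=
  ∀ φ ∈ T, ∀ I ∈ M, φ.Sat M M I Fin.elim0

/-- `mod(T)`, the greatest set `M` of interpretations with `M ⊨ T`. It is defined as the union of
all such sets, which is the greatest one if a greatest one exists; for first-order theories it
always exists, see `isGreatest_mod`. -/
def mod {σ : Signature.{u, v}} (T : Set (FOSentence σ)) : Set (Interp σ) :=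
  ⋃₀ {M | Models M (Subtype.val '' T)}

theorem Formula.IsFirstOrder.sat_iff {σ : Signature.{u, v}} (M N M' N' : Set (Interp σ)) :
    ∀ {n : ℕ} (φ : Formula σ n), φ.IsFirstOrder → ∀ (I : Interp σ) (e : Fin n → σ.Const),
      φ.Sat M N I e ↔ φ.Sat M' N' I e
  | _, .atom _ _, _, _, _ => Iff.rfl
  | _, .neg φ, h, I, e => not_congr (sat_iff M N M' N' φ h I e)
  | _, .conj φ ψ, h, I, e =>
      and_congr (sat_iff M N M' N' φ h.1 I e) (sat_iff M N M' N' ψ h.2 I e)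
  | _, .ex φ, h, I, _ => exists_congr fun _ => sat_iff M N M' N' φ h I _

theorem isGreatest_mod {σ : Signature.{u, v}} (T : Set (FOSentence σ)) :
    IsGreatest {M | Models M (Subtype.val '' T)} (mod T) := by
  refine ⟨?_, fun M hM => Set.subset_sUnion_of_mem hM⟩
  rintro _ ⟨φ, hφ, rfl⟩ I ⟨M, hM, hI⟩
  exact (Formula.IsFirstOrder.sat_iff M M _ _ φ.1 φ.2 I _).1 (hM _ ⟨φ, hφ, rfl⟩ I hI)

/-! ### The minimal change update semantics -/

/-- The atoms of `I` with predicate symbol `P`. -/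
def restrPred {σ : Signature.{u, v}} (P : σ.Pred) (I : Interp σ) : Set (GroundAtom σ) :=
  {p ∈ I | p.pred = P}

/-- The difference in the interpretation of `P` between `I` and `J`. -/
def diff {σ : Signature.{u, v}} (P : σ.Pred) (I J : Interp σ) : Set (GroundAtom σ) :=
  (restrPred P I \ restrPred P J) ∪ (restrPred P J \ restrPred P I)

/-- `J` is at least as close to `I` as `J'`. -/
def CloserEq {σ : Signature.{u, v}} (I J J' : Interp σ) : Prop :=
  ∀ P : σ.Pred, diff P I J ⊆ diff P I J'

/-- `J` is closer to `I` than `J'`. -/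
def Closer {σ : Signature.{u, v}} (I J J' : Interp σ) : Prop :=
  CloserEq I J J' ∧ ¬ CloserEq I J' J

/-- `I ⊕ N`. -/
def updateInterp {σ : Signature.{u, v}} (I : Interp σ) (N : Set (Interp σ)) : Set (Interp σ) :=
  {J ∈ N | ¬ ∃ J' ∈ N, Closer I J' J}

/-- `M ⊕ N`. -/
def update {σ : Signature.{u, v}} (M N : Set (Interp σ)) : Set (Interp σ) :=
  ⋃ I ∈ M, updateInterp I N

/-- `(⋯((M₀ ⊕ M₁) ⊕ M₂) ⊕ ⋯) ⊕ Mₙ₋₁`, started from the set of all interpretations `𝓘`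
(note `𝓘 ⊕ M₀ = M₀`), which is also the value for the empty sequence. -/
def updateSeq {σ : Signature.{u, v}} : (n : ℕ) → (Fin n → Set (Interp σ)) → Set (Interp σ)
  | 0, _ => Set.univ
  | n + 1, M => update (updateSeq n fun i => M i.castSucc) (M (Fin.last n))

/-- `M` is the minimal change update model of a finite sequence of first-order theories. -/
def IsMinimalChangeUpdateModel {σ : Signature.{u, v}} {n : ℕ} (T : Fin n → Set (FOSentence σ))
    (M : Set (Interp σ)) : Prop :=
  M.Nonempty ∧ M = updateSeq n fun i => mod (T i)

/-! ### Generalised logic programs and dynamic logic programs -/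

/-- Literals: ground atoms `p` and default literals `not p`. -/
inductive Literal (σ : Signature.{u, v}) : Type (max u v)
  | pos (p : GroundAtom σ)
  | naf (p : GroundAtom σ)

/-- Default negation of a literal; double default negation is absorbed. -/
def Literal.flip {σ : Signature.{u, v}} : Literal σ → Literal σ
  | .pos p => .naf p
  | .naf p => .pos p

def Literal.preds {σ : Signature.{u, v}} : Literal σ → Set σ.Pred
  | .pos p => {p.pred}
  | .naf p => {p.pred}

/-- The MKNF translation `π(p) = K p`, `π(not p) = not p` of a literal. -/
def Literal.toMKNF {σ : Signature.{u, v}} : Literal σ → Sentence σ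
  | .pos p => .know p.toSentence
  | .naf p => .naf p.toSentence

/-- Satisfaction of a literal in a Herbrand interpretation. -/
def Literal.Holds {σ : Signature.{u, v}} (I : Interp σ) : Literal σ → Prop
  | .pos p => p ∈ I
  | .naf p => p ∉ I

/-- Ground rules. -/
structure Rule (σ : Signature.{u, v}) where
  head : Literal σ
  body : Finset (Literal σ)

/-- The predicate symbols of the body of a rule. -/
def Rule.bodyPreds {σ : Signature.{u, v}} (r : Rule σ) : Set σ.Pred :=
  ⋃ L ∈ r.body, L.preds

def Rule.preds {σ : Signature.{u, v}} (r : Rule σ) : Set σ.Pred :=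
  r.head.preds ∪ r.bodyPreds

/-- A rule is positive if its head is an atom. -/
def Rule.IsPositive {σ : Signature.{u, v}} (r : Rule σ) : Prop :=
  ∃ p, r.head = .pos p

/-- A rule is a fact if its body is empty. -/
def Rule.IsFact {σ : Signature.{u, v}} (r : Rule σ) : Prop :=
  r.body = ∅

/-- `I ⊨ B(r)`. -/
def Rule.BodyHolds {σ : Signature.{u, v}} (I : Interp σ) (r : Rule σ) : Prop :=
  ∀ L ∈ r.body, L.Holds I

/-- Conflicting rules. -/
def Rule.Conflicts {σ : Signature.{u, v}} (r r' : Rule σ) : Prop :=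
  r.head = r'.head.flip

/-- A generalised logic program. -/
abbrev Program (σ : Signature.{u, v}) := Set (Rule σ)

/-- The least model of a program in which every default literal `not p` is read as a new atom, so
that the atoms of the resulting definite program are the literals. -/
def leastModel {σ : Signature.{u, v}} (R : Program σ) : Set (Literal σ) :=
  ⋂₀ {S | ∀ r ∈ R, (∀ L ∈ r.body, L ∈ S) → r.head ∈ S}

/-- The rules of a dynamic logic program with some occurrence that is not rejected: the occurrence
of `r` in the `i`-th program is rejected if a rule of the `j`-th program, `i ≤ j`, conflicts with
`r` and has a body that is true in `I`. -/
def unrejected {σ : Signature.{u, v}} {n : ℕ} (Q : Fin n → Program σ) (I : Interp σ) :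
    Program σ :=
  {r | ∃ i, r ∈ Q i ∧ ¬ ∃ j, i ≤ j ∧ ∃ r' ∈ Q j, r.Conflicts r' ∧ r'.BodyHolds I}

/-- The default assumptions `not p`, as facts. -/
def defaults {σ : Signature.{u, v}} {n : ℕ} (Q : Fin n → Program σ) (I : Interp σ) :
    Program σ :=
  {d | ∃ p : GroundAtom σ, d = ⟨.naf p, ∅⟩ ∧
    ¬ ∃ i, ∃ r ∈ Q i, r.head = .pos p ∧ r.BodyHolds I}

/-- Dynamic stable models of a dynamic logic program. -/
def IsDynamicStableModel {σ : Signature.{u, v}} {n : ℕ} (Q : Fin n → Program σ) (I : Interp σ) :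
    Prop :=
  {L : Literal σ | L.Holds I} = leastModel (unrejected Q I ∪ defaults Q I)

/-! ### Hybrid knowledge bases -/

/-- The description logic in use: its axioms, and the translation of axioms to function-free
first-order sentences. -/
structure DescriptionLogic (σ : Signature.{u, v}) where
  Ax : Type a
  toFO : Ax → FOSentence σ

/-- The predicate symbols of an axiom. -/
def DescriptionLogic.preds {σ : Signature.{u, v}} (D : DescriptionLogic.{u, v, a} σ) (φ : D.Ax) :
    Set σ.Pred :=
  (D.toFO φ).1.preds

/-- The first-order translation of an ontology. -/
def DescriptionLogic.theory {σ : Signature.{u, v}} (D : DescriptionLogic.{u, v, a} σ)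
    (O : Set D.Ax) : Set (FOSentence σ) :=
  D.toFO '' O

/-- A hybrid knowledge base `⟨O, P⟩`. -/
structure HybridKB {σ : Signature.{u, v}} (D : DescriptionLogic.{u, v, a} σ) where
  ont : Set D.Ax
  prog : Program σ

/-- The atoms `p` such that the positive fact `p` is in the program, as a first-order theory. -/
def factTheory {σ : Signature.{u, v}} (Q : Program σ) : Set (FOSentence σ) :=
  {φ | ∃ p : GroundAtom σ, (⟨.pos p, ∅⟩ : Rule σ) ∈ Q ∧ φ = p.toFO}

namespace HybridKB

variable {σ : Signature.{u, v}} {D : DescriptionLogic.{u, v, a} σ}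

def IsOntBased (K : HybridKB D) : Prop := ∀ r ∈ K.prog, r.IsPositive ∧ r.IsFact

def IsProgBased (K : HybridKB D) : Prop := K.ont = ∅

/-- `U` is a splitting set for `K`. -/
def IsSplittingSet (K : HybridKB D) (U : Set σ.Pred) : Prop :=
  (∀ φ ∈ K.ont, (D.preds φ ∩ U).Nonempty → D.preds φ ⊆ U) ∧
  (∀ r ∈ K.prog, (r.head.preds ∩ U).Nonempty → r.preds ⊆ U)

/-- The bottom `b_U(K)`. -/
def bottom (U : Set σ.Pred) (K : HybridKB D) : HybridKB D where
  ont := {φ ∈ K.ont | D.preds φ ⊆ U}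
  prog := {r ∈ K.prog | r.preds ⊆ U}

/-- The top `t_U(K)`. -/
def top (U : Set σ.Pred) (K : HybridKB D) : HybridKB D where
  ont := K.ont \ (K.bottom U).ont
  prog := K.prog \ (K.bottom U).prog

/-- The splitting set reduct `e_U(K, X)`. -/
def reduct (U : Set σ.Pred) (K : HybridKB D) (X : Set (Interp σ)) : HybridKB D where
  ont := (K.top U).ont
  prog := {r' | ∃ r ∈ (K.top U).prog,
    Models X (Literal.toMKNF '' {L | L ∈ r.body ∧ L.preds ⊆ U}) ∧
    r'.head = r.head ∧
    (r'.body : Set (Literal σ)) = {L | L ∈ r.body ∧ L.preds ⊆ Uᶜ}}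

def IsOntReducible (K : HybridKB D) (U : Set σ.Pred) : Prop :=
  ∀ r ∈ K.prog, r.IsPositive ∧ r.bodyPreds ⊆ U

def IsProgReducible (K : HybridKB D) : Prop := K.ont = ∅

end HybridKB

/-- A dynamic hybrid knowledge base of length `n`. -/
abbrev DynamicHybridKB {σ : Signature.{u, v}} (D : DescriptionLogic.{u, v, a} σ) (n : ℕ) :=
  Fin n → HybridKB D

namespace DynamicHybridKB

variable {σ : Signature.{u, v}} {D : DescriptionLogic.{u, v, a} σ} {n : ℕ}

/-- `M` is a dynamic MKNF model of a basic dynamic hybrid knowledge base. -/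
def IsBasicDynamicMKNFModel (K : DynamicHybridKB D n) (M : Set (Interp σ)) : Prop :=
  M.Nonempty ∧
  (((∀ i, (K i).IsOntBased) ∧
      IsMinimalChangeUpdateModel (fun i => D.theory (K i).ont ∪ factTheory (K i).prog) M) ∨
    ((∀ i, (K i).IsProgBased) ∧
      ∃ I : Interp σ, IsDynamicStableModel (fun i => (K i).prog) I ∧ M = {J | I ⊆ J}))

def bottom (U : Set σ.Pred) (K : DynamicHybridKB D n) : DynamicHybridKB D n :=
  fun i => (K i).bottom U

def top (U : Set σ.Pred) (K : DynamicHybridKB D n) : DynamicHybridKB D n :=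
  fun i => (K i).top U

def reduct (U : Set σ.Pred) (K : DynamicHybridKB D n) (X : Set (Interp σ)) :
    DynamicHybridKB D n :=
  fun i => (K i).reduct U X

/-- `U = ⟨U_α⟩_{α < μ}` is a splitting sequence for `K`: a nonempty, monotone, continuous sequence
of splitting sets that covers all predicate symbols. Only the values `U α` with `α < μ` matter. -/
structure IsSplittingSequence (K : DynamicHybridKB D n) (μ : Ordinal.{w})
    (U : Ordinal.{w} → Set σ.Pred) : Prop where
  pos : 0 < μ
  splitting : ∀ α < μ, ∀ i, (K i).IsSplittingSet (U α)
  mono : ∀ α β, α ≤ β → β < μ → U α ⊆ U β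
  continuous : ∀ α < μ, Order.IsSuccLimit α → U α = ⋃ η < α, U η
  cover : ⋃ α < μ, U α = Set.univ

/-- `K` is reducible relative to `U`. -/
def IsReducible (K : DynamicHybridKB D n) (U : Set σ.Pred) : Prop :=
  (∀ i, (K i).IsOntReducible U) ∨ (∀ i, (K i).IsProgReducible)

/-- `U` is an update-enabling splitting sequence for `K`. -/
structure IsUpdateEnabling (K : DynamicHybridKB D n) (μ : Ordinal.{w})
    (U : Ordinal.{w} → Set σ.Pred) : Prop extends K.IsSplittingSequence μ U where
  reducible_zero : (K.bottom (U 0)).IsReducible ∅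
  reducible_succ : ∀ α, α + 1 < μ → ((K.bottom (U (α + 1))).top (U α)).IsReducible (U α)

/-- `X = ⟨X_α⟩_{α < μ}` is a solution to `K` with respect to `U`. -/
structure IsSolution (K : DynamicHybridKB D n) (μ : Ordinal.{w}) (U : Ordinal.{w} → Set σ.Pred)
    (X : Ordinal.{w} → Set (Interp σ)) : Prop where
  nonempty : ∀ α < μ, (X α).Nonempty
  zero : (K.bottom (U 0)).IsBasicDynamicMKNFModel (X 0)
  succ : ∀ α, α + 1 < μ →
    ((K.bottom (U (α + 1))).reduct (U α) (⋂ η ≤ α, X η)).IsBasicDynamicMKNFModel (X (α + 1))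
  limit : ∀ α < μ, Order.IsSuccLimit α → X α = Set.univ

/-- `M` is a dynamic MKNF model of `K` with respect to `U`. -/
def IsDynamicMKNFModelWrt (K : DynamicHybridKB D n) (μ : Ordinal.{w})
    (U : Ordinal.{w} → Set σ.Pred) (M : Set (Interp σ)) : Prop :=
  M.Nonempty ∧ ∃ X : Ordinal.{w} → Set (Interp σ), K.IsSolution μ U X ∧ M = ⋂ α < μ, X α

/-- `M` is a dynamic MKNF model of the updatable dynamic hybrid knowledge base `K`: it is one with
respect to some update-enabling splitting sequence for `K`. -/
def IsDynamicMKNFModel (K : DynamicHybridKB D n) (M : Set (Interp σ)) : Prop :=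
  ∃ (μ : Ordinal.{w}) (U : Ordinal.{w} → Set σ.Pred),
    K.IsUpdateEnabling μ U ∧ K.IsDynamicMKNFModelWrt μ U M

end DynamicHybridKB

end MKNF

/-!
`J` is closer to `I` than `J'` exactly when `I ∆ J ⊂ I ∆ J'`. Hence, if two sets of interpretations
are constrained class by class along a partition of the ground atoms, an interpretation of minimal
distance can be sought in each class separately: `⊕` commutes with intersections of cylinders over
disjoint sets of atoms.

A splitting sequence assigns to every predicate symbol the stage at which it first occurs, and the
splitting property forces all predicate symbols of an axiom to have the same stage. The ontologies
thus fall into layers over disjoint sets of atoms, the layers at limit stages being empty by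
continuity. Without rules, the component `X α` of a solution is the minimal change update model of
layer `α`, so the intersection of a solution is the minimal change update model of the ontologies.
Conversely, the sequence consisting only of the set of all predicate symbols is update-enabling.
-/

namespace MKNF

open scoped symmDiff

variable {σ : Signature.{u, v}}

theorem Formula.preds_nonempty : ∀ {n : ℕ} (φ : Formula σ n), φ.preds.Nonempty
  | _, .atom P _ => Set.singleton_nonempty P
  | _, .neg φ => φ.preds_nonempty
  | _, .conj φ _ => φ.preds_nonempty.mono Set.subset_union_left
  | _, .ex φ => φ.preds_nonempty
  | _, .know φ => φ.preds_nonempty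
  | _, .naf φ => φ.preds_nonempty

theorem Formula.IsFirstOrder.sat_congr (M N : Set (Interp σ)) {I J : Interp σ} :
    ∀ {n : ℕ} (φ : Formula σ n), φ.IsFirstOrder →
      (∀ p : GroundAtom σ, p.pred ∈ φ.preds → (p ∈ I ↔ p ∈ J)) → ∀ e : Fin n → σ.Const,
      φ.Sat M N I e ↔ φ.Sat M N J e
  | _, .atom _ _, _, h, _ => h _ rfl
  | _, .neg φ, hφ, h, e => not_congr (sat_congr M N φ hφ h e)
  | _, .conj φ ψ, hφ, h, e =>
      and_congr (sat_congr M N φ hφ.1 (fun p hp => h p (Or.inl hp)) e)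
        (sat_congr M N ψ hφ.2 (fun p hp => h p (Or.inr hp)) e)
  | _, .ex φ, hφ, h, _ => exists_congr fun _ => sat_congr M N φ hφ h _

theorem mem_mod {T : Set (FOSentence σ)} {I : Interp σ} :
    I ∈ mod T ↔ ∀ φ ∈ T, φ.1.Sat ∅ ∅ I Fin.elim0 := by
  constructor
  · exact fun hI φ hφ => (Formula.IsFirstOrder.sat_iff _ _ _ _ φ.1 φ.2 I _).1
      ((isGreatest_mod T).1 _ (Set.mem_image_of_mem _ hφ) I hI)
  · intro h
    suffices hI : Models {I} (Subtype.val '' T) from (isGreatest_mod T).2 hI (Set.mem_singleton I)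
    rintro _ ⟨φ, hφ, rfl⟩ _ rfl
    exact (Formula.IsFirstOrder.sat_iff _ _ _ _ φ.1 φ.2 _ _).1 (h φ hφ)

theorem mod_empty : mod (∅ : Set (FOSentence σ)) = Set.univ :=
  Set.eq_univ_of_forall fun _ => mem_mod.2 fun _ h => h.elim

theorem mod_iUnion {ι : Sort*} (T : ι → Set (FOSentence σ)) :
    mod (⋃ j, T j) = ⋂ j, mod (T j) := by
  ext I
  simp only [mem_mod, Set.mem_iUnion, Set.mem_iInter]
  exact ⟨fun h j φ hφ => h φ ⟨j, hφ⟩, fun h φ ⟨j, hφ⟩ => h j φ hφ⟩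

theorem diff_eq_sep_symmDiff (P : σ.Pred) (I J : Interp σ) :
    diff P I J = {p ∈ I ∆ J | p.pred = P} := by
  ext p
  simp only [diff, restrPred, Set.mem_union, Set.mem_sdiff, Set.mem_ofPred_eq, Set.mem_symmDiff]
  tauto

theorem closerEq_iff_symmDiff_subset {I J J' : Interp σ} :
    CloserEq I J J' ↔ I ∆ J ⊆ I ∆ J' := by
  simp only [CloserEq, diff_eq_sep_symmDiff]
  exact ⟨fun h p hp => (h p.pred ⟨hp, rfl⟩).1, fun h _ _ hp => ⟨h hp.1, hp.2⟩⟩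

theorem closer_iff_symmDiff_ssubset {I J J' : Interp σ} :
    Closer I J J' ↔ I ∆ J ⊂ I ∆ J' := by
  simp only [Closer, closerEq_iff_symmDiff_subset, ssubset_iff_subset_not_subset]

theorem mem_update {A B : Set (Interp σ)} {J : Interp σ} :
    J ∈ update A B ↔ J ∈ B ∧ ∃ I ∈ A, ∀ J' ∈ B, ¬ Closer I J' J := by
  simp only [update, updateInterp, Set.mem_iUnion, Set.mem_ofPred_eq, not_exists, not_and,
    exists_prop]
  tauto

/-- `J` is closer to `I` than `J'` as far as the atoms in `V` are concerned: the localisation of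
`Closer` to a set of atoms. -/
def CloserOn (V : Set (GroundAtom σ)) (I J J' : Interp σ) : Prop :=
  (I ∆ J) ∩ V ⊂ (I ∆ J') ∩ V

theorem closerOn_congr {V : Set (GroundAtom σ)} {I I₁ J J₁ J' J'₁ : Interp σ}
    (hI : I ∩ V = I₁ ∩ V) (hJ : J ∩ V = J₁ ∩ V) (hJ' : J' ∩ V = J'₁ ∩ V) :
    CloserOn V I J J' ↔ CloserOn V I₁ J₁ J'₁ := by
  simp only [CloserOn, Set.inter_symmDiff_distrib_right, hI, hJ, hJ']

theorem closer_ite_iff_closerOn {V : Set (GroundAtom σ)} {I J J' : Interp σ} :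
    Closer I (V.ite J J') J' ↔ CloserOn V I J J' := by
  have hite : I ∆ V.ite J J' = V.ite (I ∆ J) (I ∆ J') := by
    ext p
    simp only [Set.mem_symmDiff, Set.ite, Set.mem_union, Set.mem_inter_iff, Set.mem_sdiff]
    tauto
  rw [closer_iff_symmDiff_ssubset, CloserOn, hite]
  simp only [ssubset_iff_subset_not_subset, Set.subset_def, Set.ite, Set.mem_union,
    Set.mem_inter_iff, Set.mem_sdiff]
  grind

theorem Closer.closerOn_of_ite {V : Set (GroundAtom σ)} {I J J' : Interp σ}
    (h : Closer (V.ite I J') J J') : CloserOn V I J J' := by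
  rw [closer_iff_symmDiff_ssubset] at h
  have hV : V.ite I J' ∆ J' ⊆ V := by
    rintro p (⟨⟨-, hp⟩ | ⟨hp, -⟩, hp'⟩ | ⟨hp, hp'⟩)
    · exact hp
    · exact absurd hp hp'
    · by_contra hpV
      exact hp' (Or.inr ⟨hp, hpV⟩)
  rw [← closerOn_congr (Set.ite_inter_self V I J') rfl rfl, CloserOn,
    Set.inter_eq_left.2 hV, Set.inter_eq_left.2 (h.subset.trans hV)]
  exact h

/-- Membership in `A` depends only on the truth values of the atoms in `V`. -/
def IsCylinder (V : Set (GroundAtom σ)) (A : Set (Interp σ)) : Prop :=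
  ∀ ⦃I J : Interp σ⦄, I ∩ V = J ∩ V → I ∈ A → J ∈ A

theorem isCylinder_mod {V : Set (GroundAtom σ)} {T : Set (FOSentence σ)}
    (hT : ∀ φ ∈ T, ∀ p : GroundAtom σ, p.pred ∈ φ.1.preds → p ∈ V) : IsCylinder V (mod T) := by
  refine fun I J hIJ hI => mem_mod.2 fun φ hφ => ?_
  have hagree : ∀ p : GroundAtom σ, p.pred ∈ φ.1.preds → (p ∈ I ↔ p ∈ J) := fun p hp => by
    simpa only [Set.mem_inter_iff, hT φ hφ p hp, and_true] using Set.ext_iff.1 hIJ p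
  exact (Formula.IsFirstOrder.sat_congr _ _ φ.1 φ.2 hagree _).1 (mem_mod.1 hI φ hφ)

theorem IsCylinder.mem_update_iff {V : Set (GroundAtom σ)} {A B : Set (Interp σ)}
    (hA : IsCylinder V A) (hB : IsCylinder V B) {J : Interp σ} :
    J ∈ update A B ↔ J ∈ B ∧ ∃ I ∈ A, ∀ J' ∈ B, ¬ CloserOn V I J' J := by
  refine mem_update.trans (and_congr_right fun _ => ⟨?_, ?_⟩)
  · rintro ⟨I, hI, hmin⟩
    exact ⟨I, hI, fun J' hJ' hc =>
      hmin _ (hB (Set.ite_inter_self V J' J).symm hJ') (closer_ite_iff_closerOn.2 hc)⟩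
  · rintro ⟨I, hI, hmin⟩
    exact ⟨V.ite I J, hA (Set.ite_inter_self V I J).symm hI, fun J' hJ' hc =>
      hmin J' hJ' hc.closerOn_of_ite⟩

theorem IsCylinder.update {V : Set (GroundAtom σ)} {A B : Set (Interp σ)} (hA : IsCylinder V A)
    (hB : IsCylinder V B) : IsCylinder V (update A B) := by
  intro J L hJL hJ
  obtain ⟨hJB, I, hI, hmin⟩ := (hA.mem_update_iff hB).1 hJ
  exact (hA.mem_update_iff hB).2 ⟨hB hJL hJB, I, hI, fun J' hJ' hc =>
    hmin J' hJ' ((closerOn_congr rfl rfl hJL).2 hc)⟩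

theorem update_univ : update Set.univ (Set.univ : Set (Interp σ)) = Set.univ := by
  refine Set.eq_univ_of_forall fun J => mem_update.2 ⟨trivial, J, trivial, fun J' _ hc => ?_⟩
  rw [closer_iff_symmDiff_ssubset, symmDiff_self] at hc
  exact not_lt_bot hc

theorem ite_mem_iInter_of_isCylinder {ι : Type*} {V : ι → Set (GroundAtom σ)}
    (hV : Pairwise (Function.onFun Disjoint V)) {B : ι → Set (Interp σ)}
    (hB : ∀ j, IsCylinder (V j) (B j)) {i : ι} {J J' : Interp σ} (hJ : J ∈ ⋂ j, B j)
    (hJ' : J' ∈ B i) : (V i).ite J' J ∈ ⋂ j, B j := by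
  refine Set.mem_iInter.2 fun j => ?_
  obtain rfl | hij := eq_or_ne i j
  · exact hB i (Set.ite_inter_self (V i) J' J).symm hJ'
  · have hsub : V j ⊆ (V i)ᶜ := Set.subset_compl_iff_disjoint_left.2 (hV hij)
    refine hB j ?_ (Set.mem_iInter.1 hJ j)
    rw [← Set.inter_eq_right.2 hsub, ← Set.inter_assoc, ← Set.inter_assoc,
      Set.ite_inter_compl_self]

theorem update_iInter {ι : Type*} (f : GroundAtom σ → ι) {A B : ι → Set (Interp σ)}
    (hA : ∀ j, IsCylinder (f ⁻¹' {j}) (A j)) (hB : ∀ j, IsCylinder (f ⁻¹' {j}) (B j)) :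
    update (⋂ j, A j) (⋂ j, B j) = ⋂ j, update (A j) (B j) := by
  ext J
  simp only [Set.mem_iInter (s := fun j => update (A j) (B j)), (hA _).mem_update_iff (hB _)]
  rw [mem_update]
  constructor
  · rintro ⟨hJ, I, hI, hmin⟩ i
    refine ⟨Set.mem_iInter.1 hJ i, I, Set.mem_iInter.1 hI i, fun J' hJ' hc => ?_⟩
    exact hmin _ (ite_mem_iInter_of_isCylinder (pairwise_disjoint_fiber f) hB hJ hJ')
      (closer_ite_iff_closerOn.2 hc)
  · intro h
    choose hJ I hI hmin using h
    let glued : Interp σ := {p | p ∈ I (f p)}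
    have hglued : ∀ j, I j ∩ f ⁻¹' {j} = glued ∩ f ⁻¹' {j} := fun j => by
      ext p
      exact and_congr_left fun hp => by rw [← Set.mem_singleton_iff.1 hp]; rfl
    refine ⟨Set.mem_iInter.2 hJ, glued, Set.mem_iInter.2 fun j => hA j (hglued j) (hI j),
      fun J' hJ' hc => ?_⟩
    obtain ⟨hsub, p, hp, hp'⟩ := Set.ssubset_iff_exists.1 (closer_iff_symmDiff_ssubset.1 hc)
    refine hmin (f p) J' (Set.mem_iInter.1 hJ' _) ((closerOn_congr (hglued _) rfl rfl).2 ?_)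
    exact Set.ssubset_iff_exists.2
      ⟨Set.inter_subset_inter_left _ hsub, p, ⟨hp, rfl⟩, fun hpV => hp' hpV.1⟩

theorem isCylinder_updateSeq {V : Set (GroundAtom σ)} :
    ∀ (n : ℕ) {M : Fin n → Set (Interp σ)}, (∀ k, IsCylinder V (M k)) →
      IsCylinder V (updateSeq n M)
  | 0, _, _ => fun _ _ _ _ => trivial
  | n + 1, _, h => (isCylinder_updateSeq n fun k => h k.castSucc).update (h (Fin.last n))

theorem updateSeq_univ : ∀ n : ℕ, updateSeq n (fun _ => (Set.univ : Set (Interp σ))) = Set.univ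
  | 0 => rfl
  | n + 1 => by rw [updateSeq, updateSeq_univ n, update_univ]

theorem updateSeq_iInter {ι : Type*} (f : GroundAtom σ → ι) :
    ∀ (n : ℕ) {M : ι → Fin n → Set (Interp σ)}, (∀ j k, IsCylinder (f ⁻¹' {j}) (M j k)) →
      updateSeq n (fun k => ⋂ j, M j k) = ⋂ j, updateSeq n (M j)
  | 0, _, _ => Set.iInter_univ.symm
  | n + 1, M, h => by
    simp only [updateSeq]
    rw [updateSeq_iInter f n fun j k => h j k.castSucc,
      update_iInter f (fun j => isCylinder_updateSeq n fun k => h j k.castSucc)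
        fun j => h j (Fin.last n)]

theorem updateSeq_mod_iUnion {ι : Type*} (f : σ.Pred → ι) {n : ℕ}
    {T : ι → Fin n → Set (FOSentence σ)} (hT : ∀ j k, ∀ φ ∈ T j k, φ.1.preds ⊆ f ⁻¹' {j}) :
    updateSeq n (fun k => mod (⋃ j, T j k)) = ⋂ j, updateSeq n fun k => mod (T j k) := by
  simp only [mod_iUnion]
  exact updateSeq_iInter (fun p => f p.pred) n fun j k =>
    isCylinder_mod fun φ hφ _ hp => hT j k φ hφ hp

theorem factTheory_empty : factTheory (∅ : Program σ) = ∅ := by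
  simp [factTheory]

theorem IsDynamicStableModel.eq_empty {n : ℕ} {Q : Fin n → Program σ} {I : Interp σ}
    (hI : IsDynamicStableModel Q I) (hQ : ∀ i, Q i = ∅) : I = ∅ := by
  refine Set.eq_empty_of_forall_notMem fun p hp => ?_
  have hleast : Literal.pos p ∈ leastModel (unrejected Q I ∪ defaults Q I) :=
    hI ▸ (show Literal.pos p ∈ {L : Literal σ | L.Holds I} from hp)
  have hclosed : ∀ r ∈ unrejected Q I ∪ defaults Q I, r.head ∈ Set.range Literal.naf := by
    rintro r (⟨i, hr, -⟩ | ⟨q, rfl, -⟩)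
    · simp [hQ] at hr
    · exact ⟨q, rfl⟩
  obtain ⟨q, hq⟩ := hleast (Set.range Literal.naf) fun r hr _ => hclosed r hr
  cases hq

namespace DynamicHybridKB

variable {D : DescriptionLogic.{u, v, a} σ} {n : ℕ} {K : DynamicHybridKB D n}

theorem bottom_univ (K : DynamicHybridKB D n) : K.bottom Set.univ = K := by
  funext i
  simp [bottom, HybridKB.bottom]

theorem bottom_prog_eq_empty (hK : ∀ i, (K i).prog = ∅) (U : Set σ.Pred) (i : Fin n) :
    (K.bottom U i).prog = ∅ := by
  simp [bottom, HybridKB.bottom, hK]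

theorem reduct_prog_eq_empty (hK : ∀ i, (K i).prog = ∅) (U : Set σ.Pred) (X : Set (Interp σ))
    (i : Fin n) : (K.reduct U X i).prog = ∅ := by
  simp [reduct, HybridKB.reduct, HybridKB.top, hK]

theorem isBasicDynamicMKNFModel_iff_of_prog_eq_empty (hK : ∀ i, (K i).prog = ∅)
    {M : Set (Interp σ)} :
    K.IsBasicDynamicMKNFModel M ↔ IsMinimalChangeUpdateModel (fun i => D.theory (K i).ont) M := by
  have hOntBased : ∀ i, (K i).IsOntBased := fun i r hr => by simp [hK] at hr
  simp only [IsBasicDynamicMKNFModel, hK, factTheory_empty, Set.union_empty]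
  refine ⟨?_, fun h => ⟨h.1, Or.inl ⟨hOntBased, h⟩⟩⟩
  rintro ⟨hne, ⟨-, h⟩ | ⟨hont, I, hI, rfl⟩⟩
  · exact h
  · have hont' : ∀ i, (K i).ont = ∅ := hont
    refine ⟨hne, ?_⟩
    simp only [hont', DescriptionLogic.theory, Set.image_empty, mod_empty, updateSeq_univ,
      hI.eq_empty fun _ => rfl, Set.empty_subset, Set.ofPred_true]

/-- The axioms of the `i`-th ontology all of whose predicate symbols lie in the class `j` of the
partition of the predicate symbols given by `f`. -/
def ontLayer {ι : Type*} (K : DynamicHybridKB D n) (f : σ.Pred → ι) (j : ι) (i : Fin n) :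
    Set D.Ax :=
  {φ ∈ (K i).ont | D.preds φ ⊆ f ⁻¹' {j}}

theorem updateSeq_theory_eq_iInter_ontLayer {ι : Type*} {f : σ.Pred → ι}
    (hf : ∀ i, ⋃ j, K.ontLayer f j i = (K i).ont) :
    (updateSeq n fun i => mod (D.theory (K i).ont)) =
      ⋂ j, updateSeq n fun i => mod (D.theory (K.ontLayer f j i)) := by
  simp only [← hf, DescriptionLogic.theory, Set.image_iUnion]
  refine updateSeq_mod_iUnion f fun j i => ?_
  rintro _ ⟨φ, hφ, rfl⟩
  exact hφ.2

theorem ontLayer_eq_empty {ι : Type*} {f : σ.Pred → ι} {j : ι} (hj : ∀ P, f P ≠ j) (i : Fin n) :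
    K.ontLayer f j i = ∅ := by
  refine Set.eq_empty_of_forall_notMem fun φ hφ => ?_
  obtain ⟨P, hP⟩ := (D.toFO φ).1.preds_nonempty
  exact hj P (hφ.2 hP)

theorem updateSeq_ontLayer_eq_univ {ι : Type*} {f : σ.Pred → ι} {j : ι} (hj : ∀ P, f P ≠ j) :
    (updateSeq n fun i => mod (D.theory (K.ontLayer f j i))) = Set.univ := by
  simp only [ontLayer_eq_empty hj, DescriptionLogic.theory, Set.image_empty, mod_empty,
    updateSeq_univ]

/-- The stage of a sequence of sets of predicate symbols at which `P` first occurs; it is the junk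
value `0` if `P` never occurs. -/
noncomputable def entryStage (U : Ordinal.{w} → Set σ.Pred) (P : σ.Pred) : Ordinal.{w} :=
  sInf {α | P ∈ U α}

theorem entryStage_le {U : Ordinal.{w} → Set σ.Pred} {P : σ.Pred} {α : Ordinal.{w}}
    (hP : P ∈ U α) : entryStage U P ≤ α :=
  csInf_le' hP

namespace IsSplittingSequence

variable {μ : Ordinal.{w}} {U : Ordinal.{w} → Set σ.Pred}

theorem exists_mem (h : K.IsSplittingSequence μ U) (P : σ.Pred) : ∃ α < μ, P ∈ U α := by
  simpa only [Set.mem_iUnion, exists_prop] using Set.eq_univ_iff_forall.1 h.cover P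

theorem mem_entryStage (h : K.IsSplittingSequence μ U) (P : σ.Pred) : P ∈ U (entryStage U P) :=
  have ⟨α, _, hP⟩ := h.exists_mem P
  csInf_mem (s := {α | P ∈ U α}) ⟨α, hP⟩

theorem entryStage_lt (h : K.IsSplittingSequence μ U) (P : σ.Pred) : entryStage U P < μ :=
  have ⟨_, hα, hP⟩ := h.exists_mem P
  (entryStage_le hP).trans_lt hα

theorem mem_iff_entryStage_le (h : K.IsSplittingSequence μ U) {P : σ.Pred} {α : Ordinal.{w}}
    (hα : α < μ) : P ∈ U α ↔ entryStage U P ≤ α :=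
  ⟨entryStage_le, fun hle => h.mono _ _ hle hα (h.mem_entryStage P)⟩

theorem entryStage_ne_of_isSuccLimit (h : K.IsSplittingSequence μ U) (P : σ.Pred)
    {α : Ordinal.{w}} (hlim : Order.IsSuccLimit α) : entryStage U P ≠ α := by
  rintro rfl
  have hP := h.mem_entryStage P
  rw [h.continuous _ (h.entryStage_lt P) hlim] at hP
  obtain ⟨η, hη, hPη⟩ := Set.mem_iUnion₂.1 hP
  exact hη.not_ge (entryStage_le hPη)

theorem entryStage_eq_of_mem_preds (h : K.IsSplittingSequence μ U) {i : Fin n} {φ : D.Ax}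
    (hφ : φ ∈ (K i).ont) {P Q : σ.Pred} (hP : P ∈ D.preds φ) (hQ : Q ∈ D.preds φ) :
    entryStage U P = entryStage U Q := by
  have hle {P Q : σ.Pred} (hP : P ∈ D.preds φ) (hQ : Q ∈ D.preds φ) :
      entryStage U P ≤ entryStage U Q :=
    entryStage_le ((h.splitting _ (h.entryStage_lt Q) i).1 φ hφ ⟨Q, hQ, h.mem_entryStage Q⟩ hP)
  exact le_antisymm (hle hP hQ) (hle hQ hP)

theorem iUnion_ontLayer (h : K.IsSplittingSequence μ U) (i : Fin n) :
    ⋃ α, K.ontLayer (entryStage U) α i = (K i).ont := by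
  refine Set.Subset.antisymm (Set.iUnion_subset fun _ => Set.sep_subset _ _) fun φ hφ => ?_
  obtain ⟨P, hP⟩ := (D.toFO φ).1.preds_nonempty
  exact Set.mem_iUnion.2 ⟨_, hφ, fun Q hQ => h.entryStage_eq_of_mem_preds hφ hQ hP⟩

theorem bottom_zero_ont (h : K.IsSplittingSequence μ U) (i : Fin n) :
    (K.bottom (U 0) i).ont = K.ontLayer (entryStage U) 0 i := by
  ext φ
  refine and_congr_right fun _ => forall_congr' fun P => imp_congr_right fun _ => ?_
  exact (h.mem_iff_entryStage_le h.pos).trans nonpos_iff_eq_zero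

theorem bottom_succ_reduct_ont (h : K.IsSplittingSequence μ U) {α : Ordinal.{w}} (hα : α + 1 < μ)
    (X : Set (Interp σ)) (i : Fin n) :
    ((K.bottom (U (α + 1))).reduct (U α) X i).ont = K.ontLayer (entryStage U) (α + 1) i := by
  have hαμ : α < μ := (Order.lt_add_one_iff.2 le_rfl).trans hα
  have hstage : ∀ P, entryStage U P = α + 1 ↔ P ∈ U (α + 1) ∧ P ∉ U α := fun P => by
    rw [h.mem_iff_entryStage_le hα, h.mem_iff_entryStage_le hαμ, not_le, ← Order.add_one_le_iff,
      le_antisymm_iff]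
  ext φ
  simp only [reduct, HybridKB.reduct, HybridKB.top, bottom, HybridKB.bottom, ontLayer,
    Set.mem_sdiff, Set.mem_ofPred_eq]
  constructor
  · rintro ⟨⟨hφ, hsub⟩, hnot⟩
    refine ⟨hφ, fun P hP => (hstage P).2 ⟨hsub hP, fun hPα => hnot ⟨⟨hφ, hsub⟩, ?_⟩⟩⟩
    exact (h.splitting α hαμ i).1 φ hφ ⟨P, hP, hPα⟩
  · rintro ⟨hφ, hlayer⟩
    obtain ⟨P, hP⟩ := (D.toFO φ).1.preds_nonempty
    exact ⟨⟨hφ, fun Q hQ => ((hstage Q).1 (hlayer hQ)).1⟩,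
      fun hsub => ((hstage P).1 (hlayer hP)).2 (hsub.2 hP)⟩

theorem solution_eq_updateSeq_ontLayer (h : K.IsSplittingSequence μ U)
    (hK : ∀ i, (K i).prog = ∅) {X : Ordinal.{w} → Set (Interp σ)} (hX : K.IsSolution μ U X)
    {α : Ordinal.{w}} (hα : α < μ) :
    X α = updateSeq n fun i => mod (D.theory (K.ontLayer (entryStage U) α i)) := by
  rcases Ordinal.zero_or_succ_or_isSuccLimit α with rfl | ⟨β, rfl⟩ | hlim
  · have hX₀ := (isBasicDynamicMKNFModel_iff_of_prog_eq_empty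
      (bottom_prog_eq_empty hK (U 0))).1 hX.zero
    simpa only [h.bottom_zero_ont] using hX₀.2
  · rw [Order.succ_eq_add_one] at hα ⊢
    have hXβ := (isBasicDynamicMKNFModel_iff_of_prog_eq_empty
      (reduct_prog_eq_empty (bottom_prog_eq_empty hK _) _ _)).1 (hX.succ β hα)
    simpa only [h.bottom_succ_reduct_ont hα] using hXβ.2
  · rw [hX.limit α hα hlim,
      updateSeq_ontLayer_eq_univ fun P => h.entryStage_ne_of_isSuccLimit P hlim]

theorem iInter_solution (h : K.IsSplittingSequence μ U) (hK : ∀ i, (K i).prog = ∅)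
    {X : Ordinal.{w} → Set (Interp σ)} (hX : K.IsSolution μ U X) :
    ⋂ α < μ, X α = updateSeq n fun i => mod (D.theory (K i).ont) := by
  rw [updateSeq_theory_eq_iInter_ontLayer h.iUnion_ontLayer]
  refine Set.iInter_congr fun α => ?_
  by_cases hα : α < μ
  · simp only [hα, Set.iInter_true, h.solution_eq_updateSeq_ontLayer hK hX hα]
  · have hempty : ∀ P, entryStage U P ≠ α := fun P hP => hα (hP ▸ h.entryStage_lt P)
    simp only [hα, Set.iInter_false, updateSeq_ontLayer_eq_univ hempty]

end IsSplittingSequence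

theorem IsBasicDynamicMKNFModel.isReducible_empty {M : Set (Interp σ)}
    (hM : K.IsBasicDynamicMKNFModel M) : K.IsReducible ∅ := by
  refine hM.2.imp (fun h i r hr => ?_) And.left
  obtain ⟨hpos, hfact : r.body = ∅⟩ := h.1 i r hr
  exact ⟨hpos, by simp [Rule.bodyPreds, hfact]⟩

theorem isUpdateEnabling_one_univ (hK : K.IsReducible ∅) :
    K.IsUpdateEnabling (1 : Ordinal.{w}) fun _ => Set.univ where
  pos := zero_lt_one
  splitting _ _ _ := ⟨fun _ _ _ => Set.subset_univ _, fun _ _ _ => Set.subset_univ _⟩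
  mono _ _ _ _ := Set.Subset.rfl
  continuous α hα hlim := absurd (Order.lt_one_iff.1 hα) hlim.ne_bot
  cover := Set.eq_univ_of_forall fun P => Set.mem_iUnion₂.2 ⟨0, zero_lt_one, Set.mem_univ P⟩
  reducible_zero := by rwa [bottom_univ]
  reducible_succ α hα := by simp at hα

theorem IsBasicDynamicMKNFModel.isSolution_one_univ {M : Set (Interp σ)}
    (hM : K.IsBasicDynamicMKNFModel M) :
    K.IsSolution (1 : Ordinal.{w}) (fun _ => Set.univ) fun _ => M where
  nonempty _ _ := hM.1
  zero := by rwa [bottom_univ]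
  succ α hα := by simp at hα
  limit α hα hlim := absurd (Order.lt_one_iff.1 hα) hlim.ne_bot

theorem IsBasicDynamicMKNFModel.isDynamicMKNFModel {M : Set (Interp σ)}
    (hM : K.IsBasicDynamicMKNFModel M) : IsDynamicMKNFModel.{u, v, a, w} K M := by
  refine ⟨1, fun _ => Set.univ, isUpdateEnabling_one_univ hM.isReducible_empty, hM.1, fun _ => M,
    hM.isSolution_one_univ, ?_⟩
  exact (Set.biInter_const (s := Set.Iio (1 : Ordinal.{w})) ⟨0, Set.mem_Iio.2 zero_lt_one⟩ M).symm

end DynamicHybridKB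

end MKNF

theorem mainTheorem5 {σ : MKNF.Signature.{u, v}} (D : MKNF.DescriptionLogic.{u, v, a} σ) {n : ℕ}
    (K : MKNF.DynamicHybridKB D n) (hK : ∀ i, (K i).prog = ∅) (M : Set (MKNF.Interp σ)) :
    MKNF.DynamicHybridKB.IsDynamicMKNFModel.{u, v, a, w} K M ↔
      MKNF.IsMinimalChangeUpdateModel (fun i => D.theory (K i).ont) M := by
  constructor
  · rintro ⟨μ, U, hU, hne, X, hX, rfl⟩
    exact ⟨hne, hU.toIsSplittingSequence.iInter_solution hK hX⟩
  · intro hM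
    exact ((MKNF.DynamicHybridKB.isBasicDynamicMKNFModel_iff_of_prog_eq_empty hK).2
      hM).isDynamicMKNFModel
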